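/- Let $\mathfrak S$ be the real algebra of sedenions, obtained from $\mathbb R$ (with trivial conjugation) by four Cayley–Dickson doublings $A\mapsto A+Ae$, $$(a+be)(c+de)=ac-\overline d\,b+(da+b\overline c)e,\qquad \overline{a+be}=\overline a-be,$$ and let $\langle\cdot,\cdot\rangle$ be the Euclidean inner product of the sixteen real coordinates on $\mathfrak S$. For $s\in\mathfrak S$ let $L_s:\mathfrak S\to\mathfrak S$, $L_s(a)=sa$, and put $\langle L_b,L_c\rangle:=\langle b,c\rangle$, $|L_b|:=\langle b,b\rangle^{1/2}$. Let $$\mathcal C_{\mathfrak S}=\{L_s: s\in\mathfrak S,\ L_s^2=-\mathrm{id}\},\qquad \mathbb C_I=\mathbb R+\mathbb R I\ (I\in\mathcal C_{\mathfrak S}),\qquad \mathcal W_{\mathfrak S}=\bigcup_{I\in\mathcal C_{\mathfrak S}}\mathbb C_I,$$ where real numbers are identified with real multiples of the identity operator. A set $\Omega\subset\mathcal W_{\mathfrak S}$ is *slice-open* if $\Omega_I:=\Omega\cap\mathbb C_I$ is open in the plane $\mathbb C_I$ for every $I\in\mathcal C_{\mathfrak S}$; the slice-open sets form a topology, and *slice-connected*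 means connected in it. For slice-open $\Omega$, a function $f:\Omega\to\mathfrak S$ is *slice regular* if for every $I\in\mathcal C_{\mathfrak S}$ the restriction $f_I=f|_{\Omega_I}$ is real differentiable and $$\tfrac12\Big(\frac{\partial}{\partial x}+I\frac{\partial}{\partial y}\Big)f_I(x+yI)=0\quad\text{on }\Omega_I .$$ A slice-open set $\Omega\subset\mathcal W_{\mathfrak S}$ is a *domain of slice regularity* if there are no slice-open sets $\Omega_1,\Omega_2\subset\mathcal W_{\mathfrak S}$ such that 1. $\varnothing\ne\Omega_1\subset\Omega_2\cap\Omega$; 2. $\Omega_2$ is slice-connected and not contained in $\Omega$; 3. for every slice regular function $f$ on $\Omega$ there is a slice regular function $\widetilde f$ on $\Omega_2$ with $f=\widetilde f$ on $\Omega_1$. Fix $I_0\in\mathcal C_{\mathfrak S}$. For $p\in\mathcal W_{\mathfrak S}$ let $\mathrm{Re}(p)=\langle p,1\rangle$; let $I_p=I_0$ if $p\in\mathbb R$ and $I_p=\dfrac{p-\mathrm{Re}(p)}{|p-\mathrm{Re}(p)|}$ otherwise; and let $z_p=\mathrm{Re}(p)+\langle p,I_p\rangle\, i\in\mathbb C$.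 For $0<r<\infty$ and $z\in\mathbb C$ let $B(z,r)=\{w\in\mathbb C:|w-z|<r\}$. The *$\sigma$-ball* with center $p$ and radius $r$ is $$\Sigma(p,r)=\Big\{x+yJ:\ J\in\mathcal C_{\mathfrak S},\ x+yi\in B(z_p,r)\cap B(\overline{z_p},r)\Big\}\ \cup\ \Big\{x+yI_p:\ x+yi\in B(z_p,r)\Big\}.$$ **Proposition.** For every $p\in\mathcal W_{\mathfrak S}$ and every $r\in(0,+\infty)$, the $\sigma$-ball $\Sigma(p,r)$ is a domain of slice regularity (in particular, it is slice-open). -/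

import Mathlib

/-- The Cayley-Dickson double of `A`: the pair `⟨a, b⟩` stands for `a + b e`. -/
@[ext]
structure CayleyDickson (A : Type) : Type where
  fst : A
  snd : A

namespace CayleyDickson

section Operations

variable {A : Type}

instance [Zero A] : Zero (CayleyDickson A) := ⟨⟨0, 0⟩⟩
instance [Zero A] [One A] : One (CayleyDickson A) := ⟨⟨1, 0⟩⟩
instance [Add A] : Add (CayleyDickson A) := ⟨fun x y => ⟨x.fst + y.fst, x.snd + y.snd⟩⟩
instance [Neg A] : Neg (CayleyDickson A) := ⟨fun x => ⟨-x.fst, -x.snd⟩⟩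
instance [SMul ℝ A] : SMul ℝ (CayleyDickson A) := ⟨fun t x => ⟨t • x.fst, t • x.snd⟩⟩

/-- `(a + b e)(c + d e) = (a c - d̄ b) + (d a + b c̄) e`. -/
instance [Add A] [Sub A] [Mul A] [Star A] : Mul (CayleyDickson A) :=
  ⟨fun x y => ⟨x.fst * y.fst - star y.snd * x.snd, y.snd * x.fst + x.snd * star y.fst⟩⟩

/-- The conjugate of `a + b e` is `ā - b e`. -/
instance [Neg A] [Star A] : Star (CayleyDickson A) := ⟨fun x => ⟨star x.fst, -x.snd⟩⟩

@[simp] theorem zero_fst [Zero A] : (0 : CayleyDickson A).fst = 0 := rfl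
@[simp] theorem zero_snd [Zero A] : (0 : CayleyDickson A).snd = 0 := rfl
@[simp] theorem one_fst [Zero A] [One A] : (1 : CayleyDickson A).fst = 1 := rfl
@[simp] theorem one_snd [Zero A] [One A] : (1 : CayleyDickson A).snd = 0 := rfl
@[simp] theorem add_fst [Add A] (x y : CayleyDickson A) : (x + y).fst = x.fst + y.fst := rfl
@[simp] theorem add_snd [Add A] (x y : CayleyDickson A) : (x + y).snd = x.snd + y.snd := rfl
@[simp] theorem neg_fst [Neg A] (x : CayleyDickson A) : (-x).fst = -x.fst := rfl
@[simp] theorem neg_snd [Neg A] (x : CayleyDickson A) : (-x).snd = -x.snd := rfl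
@[simp] theorem smul_fst [SMul ℝ A] (t : ℝ) (x : CayleyDickson A) : (t • x).fst = t • x.fst := rfl
@[simp] theorem smul_snd [SMul ℝ A] (t : ℝ) (x : CayleyDickson A) : (t • x).snd = t • x.snd := rfl
@[simp] theorem mul_fst [Add A] [Sub A] [Mul A] [Star A] (x y : CayleyDickson A) :
    (x * y).fst = x.fst * y.fst - star y.snd * x.snd := rfl
@[simp] theorem mul_snd [Add A] [Sub A] [Mul A] [Star A] (x y : CayleyDickson A) :
    (x * y).snd = y.snd * x.fst + x.snd * star y.fst := rfl
@[simp] theorem star_fst [Neg A] [Star A] (x : CayleyDickson A) : (star x).fst = star x.fst := rfl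
@[simp] theorem star_snd [Neg A] [Star A] (x : CayleyDickson A) : (star x).snd = -x.snd := rfl

end Operations

section Algebra

variable {A : Type} [NonAssocRing A] [StarRing A] [Module ℝ A]

instance : AddCommGroup (CayleyDickson A) where
  add_assoc x y z := by ext <;> simp [add_assoc]
  zero_add x := by ext <;> simp
  add_zero x := by ext <;> simp
  add_comm x y := by ext <;> simp [add_comm]
  neg_add_cancel x := by ext <;> simp
  nsmul := nsmulRec
  zsmul := zsmulRec

instance : NonAssocRing (CayleyDickson A) where
  left_distrib x y z := by ext <;> simp [mul_add, add_mul] <;> abel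
  right_distrib x y z := by ext <;> simp [mul_add, add_mul] <;> abel
  zero_mul x := by ext <;> simp
  mul_zero x := by ext <;> simp
  one_mul x := by ext <;> simp
  mul_one x := by ext <;> simp
  zsmul := zsmulRec
  neg_add_cancel x := neg_add_cancel x

instance : StarRing (CayleyDickson A) where
  star_involutive x := by ext <;> simp
  star_mul x y := by
    ext
    · simp
    · simp [add_comm]
  star_add x y := by ext <;> simp [add_comm]

instance : Module ℝ (CayleyDickson A) where
  one_smul x := by ext <;> simp
  mul_smul s t x := by ext <;> simp [mul_smul]
  smul_zero t := by ext <;> simp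
  smul_add t x y := by ext <;> simp
  add_smul s t x := by ext <;> simp [add_smul]
  zero_smul x := by ext <;> simp

instance [StarModule ℝ A] : StarModule ℝ (CayleyDickson A) where
  star_smul t x := by ext <;> simp

instance [StarModule ℝ A] [IsScalarTower ℝ A A] [SMulCommClass ℝ A A] :
    IsScalarTower ℝ (CayleyDickson A) (CayleyDickson A) where
  smul_assoc t x y := by
    ext <;> simp [smul_sub, smul_mul_assoc, mul_smul_comm]

instance [StarModule ℝ A] [IsScalarTower ℝ A A] [SMulCommClass ℝ A A] :
    SMulCommClass ℝ (CayleyDickson A) (CayleyDickson A) where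
  smul_comm t x y := by
    ext <;> simp [smul_sub, smul_mul_assoc, mul_smul_comm]

/-- The inner product on the double for which `A` and `A e` are orthogonal copies of `A`. -/
@[reducible]
def core (cA : InnerProductSpace.Core ℝ A) : InnerProductSpace.Core ℝ (CayleyDickson A) where
  inner x y := cA.inner x.fst y.fst + cA.inner x.snd y.snd
  conj_inner_symm x y := congrArg₂ (· + ·) (cA.conj_inner_symm _ _) (cA.conj_inner_symm _ _)
  re_inner_nonneg x := add_nonneg (cA.re_inner_nonneg _) (cA.re_inner_nonneg _)
  add_left x y z := by
    simp only [add_fst, add_snd, cA.add_left]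
    ring
  smul_left x y t := by
    simp only [smul_fst, smul_snd, cA.smul_left]
    ring
  definite x hx := by
    have h1 : (0 : ℝ) ≤ cA.inner x.fst x.fst := cA.re_inner_nonneg _
    have h2 : (0 : ℝ) ≤ cA.inner x.snd x.snd := cA.re_inner_nonneg _
    ext
    · exact cA.definite _ (by linarith)
    · exact cA.definite _ (by linarith)

end Algebra

@[simp] theorem sub_fst {A : Type} [NonAssocRing A] [StarRing A] (x y : CayleyDickson A) :
    (x - y).fst = x.fst - y.fst := by
  rw [sub_eq_add_neg, sub_eq_add_neg, add_fst, neg_fst]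

@[simp] theorem sub_snd {A : Type} [NonAssocRing A] [StarRing A] (x y : CayleyDickson A) :
    (x - y).snd = x.snd - y.snd := by
  rw [sub_eq_add_neg, sub_eq_add_neg, add_snd, neg_snd]

end CayleyDickson

/-- The sedenions: four Cayley-Dickson doublings of the real numbers. -/
abbrev Sedenion : Type := CayleyDickson (CayleyDickson (CayleyDickson (CayleyDickson ℝ)))

namespace Sedenion

/-- The Euclidean inner product `⟨b, c⟩ = ∑ bᵢ cᵢ` of the sixteen real coordinates. -/
@[reducible]
noncomputable def euclideanCore : InnerProductSpace.Core ℝ Sedenion :=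
  CayleyDickson.core (CayleyDickson.core (CayleyDickson.core (CayleyDickson.core
    (InnerProductSpace.toCore (𝕜 := ℝ) (E := ℝ)))))

noncomputable instance : NormedAddCommGroup Sedenion :=
  @InnerProductSpace.Core.toNormedAddCommGroup ℝ Sedenion _ _ _ euclideanCore

noncomputable instance : InnerProductSpace ℝ Sedenion :=
  InnerProductSpace.ofCore euclideanCore.toCore

/-- Real-linear operators on the sedenions. -/
abbrev Op : Type := Module.End ℝ Sedenion

/-- The left multiplications `L_s : a ↦ s a` with `L_s ∘ L_s = - id`. -/
def sliceUnits : Set Op :=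
  {I | ∃ s : Sedenion, I = LinearMap.mulLeft ℝ s ∧ I ∘ₗ I = -LinearMap.id}

/-- The operator `x + y I` for `z = x + y i`. -/
noncomputable def planeMap (I : Op) (z : ℂ) : Op := z.re • LinearMap.id + z.im • I

/-- The slice cone: the union of the planes `ℂ_I = ℝ + ℝ I` over all `I ∈ sliceUnits`. -/
def SliceCone : Type := {T : Op // ∃ I ∈ sliceUnits, ∃ z : ℂ, T = planeMap I z}

namespace SliceCone

/-- The parametrization `x + y i ↦ x + y I` of the plane `ℂ_I` inside the slice cone. -/
noncomputable def mk (I : sliceUnits) (z : ℂ) : SliceCone :=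
  ⟨planeMap I z, I, I.2, z, rfl⟩

/-- The slice topology: `Ω` is open iff `Ω ∩ ℂ_I` is open in the plane `ℂ_I ≃ ℂ` for all `I`. -/
instance : TopologicalSpace SliceCone where
  IsOpen Ω := ∀ I : sliceUnits, IsOpen (mk I ⁻¹' Ω)
  isOpen_univ _ := isOpen_univ
  isOpen_inter _ _ hs ht I := (hs I).inter (ht I)
  isOpen_sUnion S hS I := by
    rw [Set.preimage_sUnion]
    exact isOpen_biUnion fun t ht => hS t ht I

end SliceCone

/-- Slice regularity of `f` on a slice-open set `Ω`: for each `I`, the function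
`f_I (x + y I)` is real differentiable on `Ω ∩ ℂ_I` and `(1/2) (∂/∂x + I ∂/∂y) f_I = 0` there. -/
def SliceRegularOn (f : SliceCone → Sedenion) (Ω : Set SliceCone) : Prop :=
  ∀ (I : sliceUnits) (z : ℂ), SliceCone.mk I z ∈ Ω →
    DifferentiableAt ℝ (fun w : ℂ => f (SliceCone.mk I w)) z ∧
    (1 / 2 : ℝ) • (fderiv ℝ (fun w : ℂ => f (SliceCone.mk I w)) z 1 +
      (I : Op) (fderiv ℝ (fun w : ℂ => f (SliceCone.mk I w)) z Complex.I)) = 0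

/-- Domains of slice regularity. -/
def IsDomainOfSliceRegularity (Ω : Set SliceCone) : Prop :=
  IsOpen Ω ∧
  ¬ ∃ Ω₁ Ω₂ : Set SliceCone, IsOpen Ω₁ ∧ IsOpen Ω₂ ∧
    (Ω₁.Nonempty ∧ Ω₁ ⊆ Ω₂ ∩ Ω) ∧
    (IsConnected Ω₂ ∧ ¬ Ω₂ ⊆ Ω) ∧
    ∀ f : SliceCone → Sedenion, SliceRegularOn f Ω →
      ∃ g : SliceCone → Sedenion, SliceRegularOn g Ω₂ ∧ Set.EqOn f g Ω₁

/-- `⟨L_b, L_c⟩ = ⟨b, c⟩`; note that `L_b 1 = b`. -/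
noncomputable def opInner (S T : Op) : ℝ := inner ℝ (S 1) (T 1)

/-- `Re p = ⟨p, 1⟩`. -/
noncomputable def rePart (p : SliceCone) : ℝ := opInner p.1 LinearMap.id

/-- `p - Re p`. -/
noncomputable def imOp (p : SliceCone) : Op := p.1 - rePart p • LinearMap.id

open Classical in
/-- `I_p`: the fixed unit `I₀` if `p` is real, and `(p - Re p) / |p - Re p|` otherwise. -/
noncomputable def unitOf (I₀ : sliceUnits) (p : SliceCone) : Op :=
  if imOp p = 0 then I₀ else (Real.sqrt (opInner (imOp p) (imOp p)))⁻¹ • imOp p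

/-- `z_p = Re p + ⟨p, I_p⟩ i`. -/
noncomputable def complexOf (I₀ : sliceUnits) (p : SliceCone) : ℂ :=
  ⟨rePart p, opInner p.1 (unitOf I₀ p)⟩

/-- The σ-ball `Σ(p, r)`, for `0 < r < ∞`: the points `x + y J`, `J` any slice unit, with `x + y i`
in `B(z_p, r) ∩ B(z̄_p, r)`, together with the points `x + y I_p` with `x + y i` in `B(z_p, r)`. -/
def sigmaBall (I₀ : sliceUnits) (p : SliceCone) (r : ℝ) : Set SliceCone :=
  {q | (∃ J : sliceUnits, ∃ z ∈ Metric.ball (complexOf I₀ p) r ∩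
          Metric.ball (starRingEnd ℂ (complexOf I₀ p)) r, q.1 = planeMap J z) ∨
       ∃ z ∈ Metric.ball (complexOf I₀ p) r, q.1 = planeMap (unitOf I₀ p) z}

end Sedenion

/-!
A slice regular function on a σ-ball can be given a pole at any point outside it, and this is the only
obstruction needed.

Write `B` for the disc `B(z_p, r)` and `I` for the unit `I_p`. For `c ∉ B` the `I`-holomorphic function
`z ↦ (z - c)_I⁻¹ a` on `B` extends to the slice cone by the representation formula
`f (x + y J) = ½ (1 - J I) F(z) + ½ (1 + J I) F(z̄)`. Since `1 - J I` and `1 + J I` intertwine `I` with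
`J` and `-J`, the extension equals, up to the factor `½`,
`(z - c)_J⁻¹ (1 - J I) a + (z - c̄)_J⁻¹ (1 + J I) a`
(`poleFormula`), which is slice regular on `Σ(p, r)`. On a plane `ℂ_K` with `K ≠ -I` it has a genuine
pole at `c` for a suitable `a`, because `K I ≠ 1` (`exists_poleFunction_ne`); only one nonzero vector
`(1 - K I) a` is needed, so zero divisors of the sedenions do no harm. Exchanging the coordinates
`(K, c)` and `(-K, c̄)` of a point, every point outside `Σ(p, r)` is covered
(`exists_sliceRegularOn_sigmaBall_ne`).

Suppose now that all slice regular `f` on `Σ(p, r)` extend from `Ω₁` to functions `g_f` on a connected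
`Ω₂`. Let `W` be the set of points of `Ω₂ ∩ Σ(p, r)` near which, on some plane, `f = g_f` for all `f` at
once (`coincidenceSet`). By the identity principle `W` is slice-open, and closed in `Ω₂ ∩ Σ(p, r)`. It
is also closed in `Ω₂`: were a point of `Ω₂` outside `Σ(p, r)` a limit of `W` in a plane `ℂ_K`, the
function `f` with a pole there would agree, along a set accumulating at the pole, with the
continuous function `g_f`. So `W = Ω₂`, and `Ω₂ ⊆ Σ(p, r)`.

The remaining input from the algebra is that `s s = -1` forces `s` to be a unit vector orthogonal to
`1` (`CayleyDickson.IsQuadratic.of_mul_self_eq_neg_one`). It makes coordinates on the slice cone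
unique up to the obvious ambiguities (`planeMap_eq_planeMap`) and `I_p` a slice unit (`unitOf_mem`).
-/

open Filter Topology

/-! ### Quadratic identities and slice units -/

namespace CayleyDickson

variable {A : Type} [NonAssocRing A] [StarRing A] [Module ℝ A]

/-- An inner product on a real algebra with conjugation is *quadratic* if `x + x̄ = 2⟨x, 1⟩`,
`x̄ x = ⟨x, x⟩` and `⟨1, 1⟩ = 1`. Unlike associativity or alternativity, this property survives
every Cayley-Dickson doubling. -/
structure IsQuadratic (cA : InnerProductSpace.Core ℝ A) : Prop where
  add_star : ∀ x : A, x + star x = (2 * cA.inner x 1) • (1 : A)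
  star_mul_self : ∀ x : A, star x * x = cA.inner x x • (1 : A)
  inner_one : cA.inner 1 1 = 1

theorem IsQuadratic.double [IsScalarTower ℝ A A] [SMulCommClass ℝ A A]
    {cA : InnerProductSpace.Core ℝ A}
    (h : IsQuadratic cA) : IsQuadratic (core cA) where
  add_star x := by
    have h0 : cA.inner x.snd 0 = 0 := by
      have := @InnerProductSpace.Core.inner_zero_right ℝ A _ _ _ cA.toCore x.snd
      exact this
    ext
    · change x.fst + star x.fst = (2 * (cA.inner x.fst 1 + cA.inner x.snd 0)) • (1 : A)
      rw [h.add_star, h0, add_zero]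
    · simp
  star_mul_self x := by
    ext
    · change star x.fst * x.fst - star x.snd * -x.snd
        = (cA.inner x.fst x.fst + cA.inner x.snd x.snd) • (1 : A)
      rw [mul_neg, sub_neg_eq_add, h.star_mul_self, h.star_mul_self, add_smul]
    · simp
  inner_one := by
    have h0 : cA.inner 0 0 = 0 := by
      have := @InnerProductSpace.Core.inner_zero_right ℝ A _ _ _ cA.toCore 0
      exact this
    change cA.inner 1 1 + cA.inner 0 0 = 1
    rw [h.inner_one, h0, add_zero]

theorem IsQuadratic.smul_one_eq_zero {cA : InnerProductSpace.Core ℝ A} (h : IsQuadratic cA) {t : ℝ}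
    (ht : t • (1 : A) = 0) : t = 0 := by
  have h1 := congrArg (fun a => cA.inner a 1) ht
  have h2 := cA.smul_left 1 1 t
  have h3 : cA.inner 0 1 = 0 := @InnerProductSpace.Core.inner_zero_left ℝ A _ _ _ cA.toCore 1
  rw [h.inner_one, conj_trivial, mul_one] at h2
  exact h2.symm.trans (h1.trans h3)

/-- An element with square `-1` is a unit vector orthogonal to `1`. -/
theorem IsQuadratic.of_mul_self_eq_neg_one [IsScalarTower ℝ A A]
    {cA : InnerProductSpace.Core ℝ A} (h : IsQuadratic cA) {s : A} (hs : s * s = -1) :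
    cA.inner s 1 = 0 ∧ cA.inner s s = 1 := by
  set t := cA.inner s 1
  set n := cA.inner s s
  -- multiply `s + s̄ = 2t` by `s` on the right
  have key : (2 * t) • s = (n - 1) • (1 : A) := by
    have h1 : (s + star s) * s = (2 * t) • s := by
      rw [h.add_star, smul_mul_assoc, one_mul]
    rw [← h1, add_mul, hs, h.star_mul_self, sub_smul, one_smul]
    abel
  have ht0 : t = 0 := by
    by_contra htne
    -- otherwise `s` is real, and a real square is not `-1`
    have hs1 : s = ((n - 1) / (2 * t)) • (1 : A) := by
      rw [div_eq_inv_mul, mul_smul, ← key, smul_smul, inv_mul_cancel₀ (by positivity), one_smul]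
    have h2 : (((n - 1) / (2 * t)) ^ 2 + 1) • (1 : A) = 0 := by
      have h3 := hs
      rw [hs1, smul_mul_assoc, one_mul, smul_smul] at h3
      rw [add_smul, one_smul, pow_two, h3, neg_add_cancel]
    have h4 := h.smul_one_eq_zero h2
    have h5 : 0 < ((n - 1) / (2 * t)) ^ 2 + 1 := by positivity
    exact h5.ne' h4
  rw [ht0, mul_zero, zero_smul] at key
  exact ⟨ht0, sub_eq_zero.mp (h.smul_one_eq_zero key.symm)⟩

/-- The coordinates of a double, as a linear isomorphism. -/
def equivProd : CayleyDickson A ≃ₗ[ℝ] A × A where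
  toFun x := (x.fst, x.snd)
  invFun x := ⟨x.1, x.2⟩
  map_add' _ _ := rfl
  map_smul' _ _ := rfl

instance [Module.Finite ℝ A] : Module.Finite ℝ (CayleyDickson A) :=
  Module.Finite.equiv equivProd.symm

end CayleyDickson

namespace Sedenion

theorem isQuadratic_euclideanCore : CayleyDickson.IsQuadratic euclideanCore := by
  refine CayleyDickson.IsQuadratic.double (CayleyDickson.IsQuadratic.double
    (CayleyDickson.IsQuadratic.double (CayleyDickson.IsQuadratic.double ⟨?_, ?_, ?_⟩)))
  · intro x
    change x + x = (2 * (inner ℝ x 1 : ℝ)) * 1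
    simp [two_mul]
  · intro x
    change x * x = (inner ℝ x x : ℝ) * 1
    simp [pow_two]
  · change (inner ℝ (1 : ℝ) (1 : ℝ) : ℝ) = 1
    simp

instance : FiniteDimensional ℝ Sedenion :=
  inferInstanceAs (Module.Finite ℝ Sedenion)

theorem inner_one_one : inner ℝ (1 : Sedenion) 1 = 1 := isQuadratic_euclideanCore.inner_one

theorem unit_apply_apply (I : sliceUnits) (a : Sedenion) : (I : Op) ((I : Op) a) = -a := by
  obtain ⟨s, -, h⟩ := I.2
  exact LinearMap.congr_fun h a

theorem unit_apply_one (I : sliceUnits) :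
    inner ℝ ((I : Op) 1) (1 : Sedenion) = 0 ∧ inner ℝ ((I : Op) 1) ((I : Op) 1) = 1 := by
  obtain ⟨s, hs, -⟩ := I.2
  have h := unit_apply_apply I 1
  rw [hs, LinearMap.mulLeft_apply, LinearMap.mulLeft_apply, mul_one] at h
  rw [hs, LinearMap.mulLeft_apply, mul_one]
  exact isQuadratic_euclideanCore.of_mul_self_eq_neg_one h

theorem neg_mem_sliceUnits {I : Op} (hI : I ∈ sliceUnits) : -I ∈ sliceUnits := by
  obtain ⟨s, rfl, h⟩ := hI
  refine ⟨-s, ?_, ?_⟩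
  · exact LinearMap.ext fun a => (neg_mul s a).symm
  · rw [LinearMap.neg_comp, LinearMap.comp_neg, neg_neg, h]

instance : Neg sliceUnits := ⟨fun I => ⟨-I, neg_mem_sliceUnits I.2⟩⟩

@[simp] theorem coe_neg_unit (I : sliceUnits) : ((-I : sliceUnits) : Op) = -I := rfl

theorem neg_neg_unit (I : sliceUnits) : - -I = I := Subtype.ext (neg_neg (I : Op))

theorem unit_ne_neg (I : sliceUnits) : I ≠ -I := fun h => by
  have h1 : (I : Op) 1 = -(I : Op) 1 := LinearMap.congr_fun (congrArg Subtype.val h) 1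
  have h2 := (unit_apply_one I).2
  have h3 : inner ℝ ((I : Op) 1) (-(I : Op) 1) = (1 : ℝ) := by rw [← h1, h2]
  rw [inner_neg_right, h2] at h3
  norm_num at h3

/-! ### Coordinates on the slice cone -/

theorem planeMap_apply (I : Op) (z : ℂ) (a : Sedenion) :
    planeMap I z a = z.re • a + z.im • I a := rfl

theorem planeMap_neg_conj (I : Op) (z : ℂ) :
    planeMap (-I) (starRingEnd ℂ z) = planeMap I z := by
  simp [planeMap]

theorem planeMap_mul_apply (I : sliceUnits) (z w : ℂ) (a : Sedenion) :
    planeMap I (z * w) a = planeMap I z (planeMap I w a) := by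
  simp only [planeMap_apply, map_add, map_smul, unit_apply_apply, Complex.mul_re, Complex.mul_im]
  module

theorem inner_planeMap_one (I : sliceUnits) (z : ℂ) :
    inner ℝ (planeMap I z 1) (1 : Sedenion) = z.re := by
  rw [planeMap_apply, inner_add_left, inner_smul_left, inner_smul_left, (unit_apply_one I).1,
    inner_one_one]
  simp

/-- Two planes `ℂ_J ≠ ℂ_K` meet only in the real axis, so a point of the slice cone has essentially
unique coordinates: up to the symmetry `x + y K = x + (-y) (-K)`, only real points are ambiguous. -/
theorem planeMap_eq_planeMap {J K : sliceUnits} {z w : ℂ} (h : planeMap J z = planeMap K w) :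
    (J = K ∧ z = w) ∨ (J = -K ∧ z = starRingEnd ℂ w) ∨ (z = w ∧ z.im = 0) := by
  have hre : z.re = w.re := by
    rw [← inner_planeMap_one J, ← inner_planeMap_one K, h]
  have him : ∀ a, z.im • (J : Op) a = w.im • (K : Op) a := fun a => by
    have := LinearMap.congr_fun h a
    rw [planeMap_apply, planeMap_apply, hre] at this
    exact add_left_cancel this
  have hn : z.im * z.im = w.im * w.im := by
    have h1 : inner ℝ (z.im • (J : Op) 1) (z.im • (J : Op) 1) =
        inner ℝ (w.im • (K : Op) 1) (w.im • (K : Op) 1) := by rw [him]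
    simpa only [inner_smul_left, inner_smul_right, (unit_apply_one J).2,
      (unit_apply_one K).2, conj_trivial, mul_one] using h1
  rcases eq_or_ne z.im 0 with h0 | h0
  · refine Or.inr (Or.inr ⟨Complex.ext hre ?_, h0⟩)
    rw [h0, mul_zero] at hn
    rw [h0, mul_self_eq_zero.mp hn.symm]
  · rcases mul_self_eq_mul_self_iff.mp hn with h1 | h1
    · refine Or.inl ⟨Subtype.ext (LinearMap.ext fun a => ?_), Complex.ext hre h1⟩
      have := him a
      rw [← h1] at this
      exact smul_right_injective _ h0 this
    · refine Or.inr (Or.inl ⟨Subtype.ext (LinearMap.ext fun a => ?_), Complex.ext hre h1⟩)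
      have := him a
      rw [← neg_eq_iff_eq_neg.mpr h1, neg_smul, ← smul_neg] at this
      exact smul_right_injective _ h0 this

namespace SliceCone

theorem mk_neg_conj (I : sliceUnits) (z : ℂ) : mk (-I) (starRingEnd ℂ z) = mk I z :=
  Subtype.ext (planeMap_neg_conj I z)

theorem mk_eq_mk {J K : sliceUnits} {z w : ℂ} (h : mk J z = mk K w) :
    (J = K ∧ z = w) ∨ (J = -K ∧ z = starRingEnd ℂ w) ∨ (z = w ∧ z.im = 0) :=
  planeMap_eq_planeMap (congrArg Subtype.val h)

theorem mk_eq_mk_of_im_eq_zero (J K : sliceUnits) {z : ℂ} (hz : z.im = 0) : mk J z = mk K z := by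
  refine Subtype.ext ?_
  change planeMap J z = planeMap K z
  simp [planeMap, hz]

theorem exists_mk_eq (q : SliceCone) : ∃ (K : sliceUnits) (z : ℂ), mk K z = q := by
  obtain ⟨T, I, hI, z, rfl⟩ := q
  exact ⟨⟨I, hI⟩, z, rfl⟩

end SliceCone

open SliceCone

theorem unitOf_mem (I₀ : sliceUnits) (p : SliceCone) : unitOf I₀ p ∈ sliceUnits := by
  obtain ⟨I, z, rfl⟩ := exists_mk_eq p
  have hre : rePart (mk I z) = z.re := inner_planeMap_one I z
  have him : imOp (mk I z) = z.im • (I : Op) := by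
    rw [imOp, hre]
    simp [SliceCone.mk, planeMap]
  have hnorm : Real.sqrt (opInner (z.im • (I : Op)) (z.im • (I : Op))) = |z.im| := by
    rw [opInner, LinearMap.smul_apply, inner_smul_left, inner_smul_right, (unit_apply_one I).2,
      mul_one]
    exact Real.sqrt_mul_self_eq_abs _
  rw [unitOf]
  split_ifs with h0
  · exact I₀.2
  · rw [him] at h0
    have hz : z.im ≠ 0 := fun h => h0 (by rw [h, zero_smul])
    rw [him, hnorm, smul_smul]
    rcases abs_choice z.im with h | h
    · rw [h, inv_mul_cancel₀ hz, one_smul]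
      exact I.2
    · rw [h, inv_neg, neg_mul, inv_mul_cancel₀ hz, neg_one_smul]
      exact neg_mem_sliceUnits I.2

theorem mk_mem_sigmaBall_iff {I₀ : sliceUnits} {p : SliceCone} {r : ℝ} {K : sliceUnits} {z : ℂ} :
    mk K z ∈ sigmaBall I₀ p r ↔
      (z ∈ Metric.ball (complexOf I₀ p) r ∧ starRingEnd ℂ z ∈ Metric.ball (complexOf I₀ p) r) ∨
      (K = ⟨unitOf I₀ p, unitOf_mem I₀ p⟩ ∧ z ∈ Metric.ball (complexOf I₀ p) r) ∨
      (K = -⟨unitOf I₀ p, unitOf_mem I₀ p⟩ ∧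
        starRingEnd ℂ z ∈ Metric.ball (complexOf I₀ p) r) := by
  have hball : ∀ w, w ∈ Metric.ball (starRingEnd ℂ (complexOf I₀ p)) r ↔
      starRingEnd ℂ w ∈ Metric.ball (complexOf I₀ p) r := fun w => by
    rw [Metric.mem_ball, Metric.mem_ball, Complex.dist_conj_comm]
  constructor
  · rintro (⟨J, w, ⟨hw1, hw2⟩, h⟩ | ⟨w, hw, h⟩)
    · rw [hball] at hw2
      rcases planeMap_eq_planeMap (J := K) (K := J) h with ⟨-, rfl⟩ | ⟨-, rfl⟩ | ⟨rfl, -⟩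
      · exact Or.inl ⟨hw1, hw2⟩
      · exact Or.inl ⟨hw2, by rwa [Complex.conj_conj]⟩
      · exact Or.inl ⟨hw1, hw2⟩
    · rcases planeMap_eq_planeMap (J := K) (K := ⟨unitOf I₀ p, unitOf_mem I₀ p⟩) h with
        ⟨h1, rfl⟩ | ⟨h1, rfl⟩ | ⟨rfl, h1⟩
      · exact Or.inr (Or.inl ⟨h1, hw⟩)
      · exact Or.inr (Or.inr ⟨h1, by rwa [Complex.conj_conj]⟩)
      · exact Or.inl ⟨hw, by rwa [Complex.conj_eq_iff_im.mpr h1]⟩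
  · rintro (⟨h1, h2⟩ | ⟨rfl, h⟩ | ⟨rfl, h⟩)
    · exact Or.inl ⟨K, z, ⟨h1, (hball z).mpr h2⟩, rfl⟩
    · exact Or.inr ⟨z, h, rfl⟩
    · refine Or.inr ⟨_, h, ?_⟩
      change planeMap (-unitOf I₀ p) z = _
      rw [← planeMap_neg_conj, neg_neg]

theorem isOpen_sigmaBall (I₀ : sliceUnits) (p : SliceCone) (r : ℝ) :
    IsOpen (sigmaBall I₀ p r) := by
  intro K
  have hconj : IsOpen {z : ℂ | starRingEnd ℂ z ∈ Metric.ball (complexOf I₀ p) r} :=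
    Metric.isOpen_ball.preimage Complex.continuous_conj
  have hset : mk K ⁻¹' sigmaBall I₀ p r =
      {z | (z ∈ Metric.ball (complexOf I₀ p) r ∧
        starRingEnd ℂ z ∈ Metric.ball (complexOf I₀ p) r) ∨
      (K = ⟨unitOf I₀ p, unitOf_mem I₀ p⟩ ∧ z ∈ Metric.ball (complexOf I₀ p) r) ∨
      (K = -⟨unitOf I₀ p, unitOf_mem I₀ p⟩ ∧
        starRingEnd ℂ z ∈ Metric.ball (complexOf I₀ p) r)} :=
    Set.ext fun z => mk_mem_sigmaBall_iff
  rw [hset]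
  exact (Metric.isOpen_ball.inter hconj).union
    ((isOpen_const.inter Metric.isOpen_ball).union (isOpen_const.inter hconj))

/-! ### Slice regular functions and the identity principle on a plane -/

theorem SliceRegularOn.mono {f : SliceCone → Sedenion} {Ω Ω' : Set SliceCone}
    (hf : SliceRegularOn f Ω) (h : Ω' ⊆ Ω) : SliceRegularOn f Ω' :=
  fun I z hz => hf I z (h hz)

theorem SliceRegularOn.fderiv_I {f : SliceCone → Sedenion} {Ω : Set SliceCone}
    (hf : SliceRegularOn f Ω) {K : sliceUnits} {z : ℂ} (hz : mk K z ∈ Ω) :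
    fderiv ℝ (fun w => f (mk K w)) z Complex.I =
      (K : Op) (fderiv ℝ (fun w => f (mk K w)) z 1) := by
  have h := (smul_eq_zero.mp (hf K z hz).2).resolve_left (by norm_num)
  rw [eq_neg_of_add_eq_zero_left h, map_neg, unit_apply_apply, neg_neg]

/-- The functional `a ↦ ⟨v, a⟩ - ⟨v, K a⟩ i`. It is complex linear for the complex structure `K`, and
these functionals separate points, so they reduce one-plane statements to scalar complex
analysis. -/
noncomputable def complexFunctional (K : sliceUnits) (v : Sedenion) : Sedenion →L[ℝ] ℂ :=
  Complex.ofRealCLM.comp (innerSL ℝ v) -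
    Complex.I • Complex.ofRealCLM.comp
      ((innerSL ℝ v).comp (LinearMap.toContinuousLinearMap (K : Op)))

theorem complexFunctional_apply (K : sliceUnits) (v a : Sedenion) :
    complexFunctional K v a =
      ((inner ℝ v a : ℝ) : ℂ) - Complex.I * ((inner ℝ v ((K : Op) a) : ℝ) : ℂ) := rfl

theorem complexFunctional_unit_apply (K : sliceUnits) (v a : Sedenion) :
    complexFunctional K v ((K : Op) a) = Complex.I * complexFunctional K v a := by
  rw [complexFunctional_apply, complexFunctional_apply, unit_apply_apply, inner_neg_right]
  push_cast
  linear_combination (inner ℝ v ((K : Op) a) : ℂ) * Complex.I_mul_I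

theorem SliceRegularOn.differentiableOn_complexFunctional {f : SliceCone → Sedenion}
    {Ω : Set SliceCone} (hf : SliceRegularOn f Ω) (K : sliceUnits) (v : Sedenion) {U : Set ℂ}
    (hUΩ : ∀ z ∈ U, mk K z ∈ Ω) :
    DifferentiableOn ℂ (fun z => complexFunctional K v (f (mk K z))) U := by
  intro z hz
  have hd := (hf K z (hUΩ z hz)).1
  have hc : HasFDerivAt (fun z => complexFunctional K v (f (mk K z)))
      ((complexFunctional K v).comp (fderiv ℝ (fun w => f (mk K w)) z)) z :=
    (complexFunctional K v).hasFDerivAt.comp z hd.hasFDerivAt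
  refine (differentiableAt_complex_iff_differentiableAt_real.mpr
    ⟨hc.differentiableAt, ?_⟩).differentiableWithinAt
  rw [hc.fderiv, ContinuousLinearMap.comp_apply, hf.fderiv_I (hUΩ z hz),
    complexFunctional_unit_apply]
  rfl

theorem SliceRegularOn.eqOn_plane {f g : SliceCone → Sedenion} {Ω : Set SliceCone}
    (hf : SliceRegularOn f Ω) (hg : SliceRegularOn g Ω) (K : sliceUnits) {U : Set ℂ}
    (hU : IsOpen U) (hUc : IsPreconnected U) (hUΩ : ∀ z ∈ U, mk K z ∈ Ω) {w : ℂ} (hw : w ∈ U)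
    (hfg : ∃ᶠ z in 𝓝[≠] w, f (mk K z) = g (mk K z)) :
    ∀ z ∈ U, f (mk K z) = g (mk K z) := by
  intro z hz
  refine ext_inner_left ℝ fun v => ?_
  have h := ((hf.differentiableOn_complexFunctional K v hUΩ).analyticOnNhd
    hU).eqOn_of_preconnected_of_frequently_eq
    ((hg.differentiableOn_complexFunctional K v hUΩ).analyticOnNhd hU) hUc hw
    (hfg.mono fun x hx => by rw [hx]) hz
  simpa [complexFunctional_apply] using congrArg Complex.re h

/-! ### Test functions with a prescribed pole -/

/-- The real-linear map `z ↦ (x + y J) b`, for `z = x + y i`. -/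
noncomputable def planeCLM (J : Op) (b : Sedenion) : ℂ →L[ℝ] Sedenion :=
  Complex.reCLM.smulRight b + Complex.imCLM.smulRight (J b)

theorem hasFDerivAt_planeMap_comp (J : Op) (b : Sedenion) {h : ℂ → ℂ} {h' z : ℂ}
    (hh : HasDerivAt h h' z) :
    HasFDerivAt (fun w => planeMap J (h w) b)
      ((planeCLM J b).comp ((ContinuousLinearMap.toSpanSingleton ℂ h').restrictScalars ℝ)) z :=
  (planeCLM J b).hasFDerivAt.comp z (hh.hasFDerivAt.restrictScalars ℝ)

/-- The `J`-holomorphic function `z ↦ (z - c)_J⁻¹ b` satisfies the Cauchy-Riemann equation away from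
its pole, and everywhere if `b = 0`. -/
theorem exists_hasFDerivAt_planeMap_inv (J : sliceUnits) {b : Sedenion} {c z : ℂ}
    (h : z ≠ c ∨ b = 0) :
    ∃ D : ℂ →L[ℝ] Sedenion, HasFDerivAt (fun w => planeMap J (w - c)⁻¹ b) D z ∧
      D 1 + (J : Op) (D Complex.I) = 0 := by
  rcases h with h | rfl
  · have hd : HasDerivAt (fun w : ℂ => (w - c)⁻¹) (-1 / (z - c) ^ 2) z :=
      ((hasDerivAt_id z).sub_const c).inv (sub_ne_zero.mpr h)
    refine ⟨_, hasFDerivAt_planeMap_comp J b hd, ?_⟩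
    generalize -1 / (z - c) ^ 2 = m
    change planeMap J ((1 : ℂ) * m) b + (J : Op) (planeMap J (Complex.I * m) b) = 0
    have hI : planeMap J (Complex.I * m) b = (J : Op) (planeMap J m b) := by
      rw [planeMap_mul_apply]
      simp [planeMap_apply]
    rw [hI, unit_apply_apply, one_mul, add_neg_cancel]
  · refine ⟨0, ?_, by simp⟩
    simp only [map_zero]
    exact hasFDerivAt_const _ _

/-- In the coordinates `x + y J`, twice the slice extension of the `I`-holomorphic function
`z ↦ (z - c)_I⁻¹ a` on the plane `ℂ_I`. The intertwining relations `(1 - J I) I = J (1 - J I)` and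
`(1 + J I) I = - J (1 + J I)` have been used to write it with inverses of `z - c` and `z - c̄`
in `ℂ_J`. -/
noncomputable def poleFormula (I : sliceUnits) (c : ℂ) (a : Sedenion) (J : sliceUnits) (z : ℂ) :
    Sedenion :=
  planeMap J (z - c)⁻¹ (a - (J : Op) ((I : Op) a)) +
    planeMap J (z - starRingEnd ℂ c)⁻¹ (a + (J : Op) ((I : Op) a))

theorem poleFormula_neg_conj (I : sliceUnits) (c : ℂ) (a : Sedenion) (J : sliceUnits) (z : ℂ) :
    poleFormula I c a (-J) (starRingEnd ℂ z) = poleFormula I c a J z := by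
  have h : ∀ (w : ℂ) (b : Sedenion),
      planeMap ((-J : sliceUnits) : Op) w b = planeMap J (starRingEnd ℂ w) b := fun w b => by
    rw [← planeMap_neg_conj J, Complex.conj_conj]
    rfl
  rw [poleFormula, poleFormula, h, h, add_comm]
  simp [map_inv₀, sub_eq_add_neg]

/-- At a real point the two terms combine to the `J`-independent value `2 (x - c)_I⁻¹ a`. -/
theorem poleFormula_of_im_eq_zero (I : sliceUnits) (c : ℂ) (a : Sedenion) (J : sliceUnits) {z : ℂ}
    (hz : z.im = 0) : poleFormula I c a J z = (2 : ℝ) • planeMap I (z - c)⁻¹ a := by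
  have h : (z - starRingEnd ℂ c)⁻¹ = starRingEnd ℂ ((z - c)⁻¹) := by
    rw [map_inv₀, map_sub, Complex.conj_eq_iff_im.mpr hz]
  rw [poleFormula, h]
  generalize (z - c)⁻¹ = m
  simp only [planeMap_apply, map_add, map_sub, unit_apply_apply, Complex.conj_re, Complex.conj_im]
  module

theorem poleFormula_congr (I : sliceUnits) (c : ℂ) (a : Sedenion) {J K : sliceUnits} {z w : ℂ}
    (h : mk J z = mk K w) : poleFormula I c a J z = poleFormula I c a K w := by
  rcases mk_eq_mk h with ⟨rfl, rfl⟩ | ⟨rfl, rfl⟩ | ⟨rfl, hz⟩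
  · rfl
  · exact poleFormula_neg_conj I c a K w
  · rw [poleFormula_of_im_eq_zero I c a J hz, poleFormula_of_im_eq_zero I c a K hz]

/-- The function on the slice cone given by `poleFormula` in coordinates. -/
noncomputable def poleFunction (I : sliceUnits) (c : ℂ) (a : Sedenion) (q : SliceCone) : Sedenion :=
  poleFormula I c a (exists_mk_eq q).choose (exists_mk_eq q).choose_spec.choose

theorem poleFunction_mk (I : sliceUnits) (c : ℂ) (a : Sedenion) (J : sliceUnits) (z : ℂ) :
    poleFunction I c a (mk J z) = poleFormula I c a J z :=
  poleFormula_congr I c a (exists_mk_eq (mk J z)).choose_spec.choose_spec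

/-- The test function is slice regular off `c` and `c̄`; moreover `c̄` is harmless in `ℂ_I`, and `c`
is harmless in `ℂ_{-I}`. -/
theorem sliceRegularOn_poleFunction {I : sliceUnits} {c : ℂ} {a : Sedenion} {Ω : Set SliceCone}
    (h : ∀ (J : sliceUnits) (z : ℂ), mk J z ∈ Ω → (z ≠ c ∨ J = -I) ∧ (z ≠ starRingEnd ℂ c ∨ J = I)) :
    SliceRegularOn (poleFunction I c a) Ω := by
  intro J z hz
  obtain ⟨h1, h2⟩ := h J z hz
  have h1' : z ≠ c ∨ a - (J : Op) ((I : Op) a) = 0 := h1.imp_right fun hJ => by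
    rw [hJ, coe_neg_unit, LinearMap.neg_apply, unit_apply_apply, neg_neg, sub_self]
  have h2' : z ≠ starRingEnd ℂ c ∨ a + (J : Op) ((I : Op) a) = 0 := h2.imp_right fun hJ => by
    rw [hJ, unit_apply_apply, add_neg_cancel]
  obtain ⟨D₁, hD₁, hc₁⟩ := exists_hasFDerivAt_planeMap_inv J h1'
  obtain ⟨D₂, hD₂, hc₂⟩ := exists_hasFDerivAt_planeMap_inv J h2'
  have hD : HasFDerivAt (fun w => poleFunction I c a (mk J w)) (D₁ + D₂) z := by
    simp only [poleFunction_mk]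
    exact hD₁.add hD₂
  refine ⟨hD.differentiableAt, ?_⟩
  rw [hD.fderiv]
  have : (D₁ + D₂) 1 + (J : Op) ((D₁ + D₂) Complex.I) = 0 := by
    rw [add_apply, add_apply, map_add,
      add_add_add_comm, hc₁, hc₂, add_zero]
  rw [this, smul_zero]

/-- If `K ≠ -I`, then for a suitable `a` the test function has a genuine pole at `c` in `ℂ_K`: it
does not agree with a function continuous at `c` along any set accumulating at `c`. -/
theorem exists_poleFunction_ne {I K : sliceUnits} (hK : K ≠ -I) (c : ℂ) :
    ∃ a : Sedenion, ∀ g : ℂ → Sedenion, ContinuousAt g c →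
      ¬ ∃ᶠ z in 𝓝[≠] c, poleFunction I c a (mk K z) = g z := by
  obtain ⟨a, ha⟩ : ∃ a : Sedenion, a - (K : Op) ((I : Op) a) ≠ 0 := by
    by_contra! hcon
    refine hK (Subtype.ext (LinearMap.ext fun a => ?_))
    rw [coe_neg_unit, LinearMap.neg_apply, ← unit_apply_apply K ((I : Op) a),
      ← sub_eq_zero.mp (hcon a)]
  refine ⟨a, fun g hg hfr => ?_⟩
  have hcont : Continuous fun q : ℂ × Sedenion => planeMap K q.1 q.2 := by
    have hK : Continuous (K : Op) := LinearMap.continuous_of_finiteDimensional _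
    simp only [planeMap_apply]
    fun_prop
  -- multiplying by `z - c` gives an identity whose two sides have different limits at `c`
  have hlim : Tendsto (fun z => planeMap K (z - c) (g z)) (𝓝[≠] c) (𝓝 0) := by
    have h1 : ContinuousAt (fun z => planeMap K (z - c) (g z)) c :=
      hcont.continuousAt.comp (f := fun z => (z - c, g z))
        ((continuousAt_id.sub continuousAt_const).prodMk hg)
    have h2 := h1.tendsto
    simp only [sub_self, planeMap_apply, Complex.zero_re, Complex.zero_im, zero_smul,
      add_zero] at h2
    exact h2.mono_left nhdsWithin_le_nhds
  have hcancel : ∀ z ≠ c, ∀ b, planeMap K (z - c) (planeMap K (z - c)⁻¹ b) = b := fun z hz b => by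
    rw [← planeMap_mul_apply, mul_inv_cancel₀ (sub_ne_zero.mpr hz)]
    simp [planeMap_apply]
  rcases eq_or_ne (starRingEnd ℂ c) c with hc | hc
  -- for real `c` the two poles merge, with the nonzero coefficient `2 a`
  · have hcongr : ∃ᶠ z in 𝓝[≠] c, planeMap K (z - c) (g z) = (2 : ℝ) • a := by
      refine (hfr.and_eventually self_mem_nhdsWithin).mono fun z hz => ?_
      rw [← hz.1, poleFunction_mk, poleFormula, hc, map_add, hcancel z hz.2, hcancel z hz.2]
      module
    have h0 : (2 : ℝ) • a = 0 :=
      tendsto_nhds_unique_of_frequently_eq tendsto_const_nhds hlim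
        (hcongr.mono fun z hz => hz.symm)
    have ha0 : a = 0 := (smul_eq_zero.mp h0).resolve_left two_ne_zero
    rw [ha0] at ha
    simp at ha
  · have hcongr : ∃ᶠ z in 𝓝[≠] c, planeMap K (z - c) (g z) = (a - (K : Op) ((I : Op) a)) +
        planeMap K ((z - c) * (z - starRingEnd ℂ c)⁻¹) (a + (K : Op) ((I : Op) a)) := by
      refine (hfr.and_eventually self_mem_nhdsWithin).mono fun z hz => ?_
      rw [← hz.1, poleFunction_mk, poleFormula, map_add, hcancel z hz.2, planeMap_mul_apply]
    have hlim2 : Tendsto (fun z => (a - (K : Op) ((I : Op) a)) +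
        planeMap K ((z - c) * (z - starRingEnd ℂ c)⁻¹) (a + (K : Op) ((I : Op) a))) (𝓝[≠] c)
        (𝓝 (a - (K : Op) ((I : Op) a))) := by
      have h1 : ContinuousAt (fun z => (z - c) * (z - starRingEnd ℂ c)⁻¹) c :=
        (continuousAt_id.sub continuousAt_const).mul
          ((continuousAt_id.sub continuousAt_const).inv₀ (sub_ne_zero.mpr hc.symm))
      have h2 : Tendsto (fun z => planeMap K ((z - c) * (z - starRingEnd ℂ c)⁻¹)
          (a + (K : Op) ((I : Op) a))) (𝓝 c) _ :=
        hcont.continuousAt.comp (f := fun z => ((z - c) * (z - starRingEnd ℂ c)⁻¹,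
          a + (K : Op) ((I : Op) a))) (h1.prodMk continuousAt_const)
      simpa [planeMap_apply] using
        (tendsto_const_nhds.add h2).mono_left (nhdsWithin_le_nhds (s := {c}ᶜ))
    exact ha (tendsto_nhds_unique_of_frequently_eq hlim2 hlim
      (hcongr.mono fun z hz => hz.symm))

/-! ### The coincidence set -/

/-- The points of `D` at which, in some coordinates `x + y K`, all functions of the family `F` agree
on one neighbourhood in `ℂ_K` with their partners in the family `G`. -/
def coincidenceSet {ι : Type*} (F G : ι → SliceCone → Sedenion) (D : Set SliceCone) :
    Set SliceCone :=
  {q ∈ D | ∃ (K : sliceUnits) (z : ℂ), mk K z = q ∧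
    ∀ᶠ w in 𝓝 z, ∀ i, F i (mk K w) = G i (mk K w)}

section

variable {ι : Type*} {F G : ι → SliceCone → Sedenion} {D : Set SliceCone}

/-- If the functions of both families are slice regular, one good system of coordinates makes all of
them good. At a real point this changes the plane, and the identity principle is applied
along the real axis, which all planes share. -/
theorem eventually_eq_of_mk_mem_coincidenceSet (hD : IsOpen D) (hF : ∀ i, SliceRegularOn (F i) D)
    (hG : ∀ i, SliceRegularOn (G i) D) {J : sliceUnits} {z : ℂ}
    (hz : mk J z ∈ coincidenceSet F G D) :
    ∀ᶠ w in 𝓝 z, ∀ i, F i (mk J w) = G i (mk J w) := by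
  obtain ⟨hzD, K, z', hmk, hev⟩ := hz
  rcases mk_eq_mk hmk with ⟨rfl, rfl⟩ | ⟨rfl, rfl⟩ | ⟨rfl, him⟩
  · exact hev
  · have h := Complex.continuous_conj.continuousAt.eventually hev
    filter_upwards [h] with w hw i
    simpa only [mk_neg_conj] using hw i
  · obtain ⟨ε, hε, hball⟩ := Metric.isOpen_iff.mp (hD J) z' hzD
    filter_upwards [Metric.ball_mem_nhds z' hε] with w hw i
    refine (hF i).eqOn_plane (hG i) J Metric.isOpen_ball
      (convex_ball z' ε).isPreconnected (fun x hx => hball hx) (Metric.mem_ball_self hε) ?_ w hw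
    have hreal : Tendsto (fun t : ℝ => z' + t) (𝓝[≠] 0) (𝓝[≠] z') := by
      refine tendsto_nhdsWithin_iff.mpr ⟨?_, ?_⟩
      · have hc : Continuous fun t : ℝ => z' + t := by fun_prop
        simpa using (hc.tendsto 0).mono_left (nhdsWithin_le_nhds (s := {0}ᶜ))
      · filter_upwards [self_mem_nhdsWithin] with t ht
        simpa using ht
    refine hreal.frequently (Eventually.frequently ?_)
    filter_upwards [hreal.eventually (nhdsWithin_le_nhds hev)] with t ht
    have ht0 : (z' + t).im = 0 := by simp [him]
    rw [mk_eq_mk_of_im_eq_zero J K ht0]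
    exact ht i

theorem isOpen_coincidenceSet (hD : IsOpen D) (hF : ∀ i, SliceRegularOn (F i) D)
    (hG : ∀ i, SliceRegularOn (G i) D) : IsOpen (coincidenceSet F G D) := by
  intro K
  refine isOpen_iff_mem_nhds.mpr fun z hz => ?_
  filter_upwards [(eventually_eq_of_mk_mem_coincidenceSet hD hF hG hz).eventually_nhds,
    (hD K).mem_nhds hz.1] with w hw hwD
  exact ⟨hwD, K, w, rfl, hw⟩

/-- The coincidence set is closed in `D`, one plane at a time. -/
theorem mk_mem_coincidenceSet_of_frequently (hD : IsOpen D) (hF : ∀ i, SliceRegularOn (F i) D)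
    (hG : ∀ i, SliceRegularOn (G i) D) {K : sliceUnits} {z : ℂ} (hz : mk K z ∈ D)
    (hfr : ∃ᶠ w in 𝓝 z, mk K w ∈ coincidenceSet F G D) : mk K z ∈ coincidenceSet F G D := by
  obtain ⟨ε, hε, hball⟩ := Metric.isOpen_iff.mp (hD K) z hz
  obtain ⟨w, hw, hwε⟩ := (hfr.and_eventually (Metric.ball_mem_nhds z hε)).exists
  have hev := eventually_eq_of_mk_mem_coincidenceSet hD hF hG hw
  refine ⟨hz, K, z, rfl, ?_⟩
  filter_upwards [Metric.ball_mem_nhds z hε] with x hx i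
  refine (hF i).eqOn_plane (hG i) K Metric.isOpen_ball (convex_ball z ε).isPreconnected
    (fun y hy => hball hy) hwε ?_ x hx
  exact ((hev.filter_mono nhdsWithin_le_nhds).mono fun y hy => hy i).frequently

end

/-! ### Slice regular functions on a σ-ball -/

/-- At a point outside the σ-ball, some slice regular function on the σ-ball has no extension that is
continuous along the plane of the point. -/
theorem exists_sliceRegularOn_sigmaBall_ne {I₀ : sliceUnits} {p : SliceCone} {r : ℝ}
    {K : sliceUnits} {c : ℂ} (hc : mk K c ∉ sigmaBall I₀ p r) :
    ∃ f, SliceRegularOn f (sigmaBall I₀ p r) ∧ ∀ g : SliceCone → Sedenion,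
      ContinuousAt (fun w => g (mk K w)) c → ¬ ∃ᶠ w in 𝓝[≠] c, f (mk K w) = g (mk K w) := by
  set I : sliceUnits := ⟨unitOf I₀ p, unitOf_mem I₀ p⟩ with hI
  have key : ∀ (J : sliceUnits) (d : ℂ), J ≠ -I → d ∉ Metric.ball (complexOf I₀ p) r →
      ∃ f, SliceRegularOn f (sigmaBall I₀ p r) ∧ ∀ g : SliceCone → Sedenion,
        ContinuousAt (fun w => g (mk J w)) d →
          ¬ ∃ᶠ w in 𝓝[≠] d, f (mk J w) = g (mk J w) := by
    intro J d hJ hd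
    obtain ⟨a, ha⟩ := exists_poleFunction_ne hJ d
    refine ⟨poleFunction I d a, sliceRegularOn_poleFunction fun L z hz => ?_,
      fun g hg => ha _ hg⟩
    have h1 : z ∈ Metric.ball (complexOf I₀ p) r → z ≠ d := fun h he => hd (he ▸ h)
    have h2 : starRingEnd ℂ z ∈ Metric.ball (complexOf I₀ p) r → z ≠ starRingEnd ℂ d :=
      fun h he => hd (by rwa [he, Complex.conj_conj] at h)
    rcases mk_mem_sigmaBall_iff.mp hz with ⟨h3, h4⟩ | ⟨h3, h4⟩ | ⟨h3, h4⟩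
    · exact ⟨Or.inl (h1 h3), Or.inl (h2 h4)⟩
    · exact ⟨Or.inl (h1 h4), Or.inr h3⟩
    · exact ⟨Or.inr h3, Or.inl (h2 h4)⟩
  rw [mk_mem_sigmaBall_iff, ← hI] at hc
  push Not at hc
  obtain ⟨hc1, hc2, hc3⟩ := hc
  by_cases hK : K ≠ -I ∧ c ∉ Metric.ball (complexOf I₀ p) r
  · exact key K c hK.1 hK.2
  -- otherwise the same point in its coordinates `x + (-y) (-K)` satisfies the hypotheses of `key`
  · have hK' : -K ≠ -I ∧ starRingEnd ℂ c ∉ Metric.ball (complexOf I₀ p) r := by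
      rcases not_and_or.mp hK with h | h
      · rw [not_not] at h
        refine ⟨fun h' => ?_, hc3 h⟩
        rw [← h] at h'
        exact unit_ne_neg K h'.symm
      · rw [not_not] at h
        refine ⟨fun h' => ?_, hc1 h⟩
        refine hc2 ?_ h
        rw [← neg_neg_unit K, h', neg_neg_unit]
    obtain ⟨f, hf, hne⟩ := key (-K) (starRingEnd ℂ c) hK'.1 hK'.2
    have hmk : ∀ w, mk (-K) w = mk K (starRingEnd ℂ w) := fun w => by
      rw [← mk_neg_conj K, Complex.conj_conj]
    refine ⟨f, hf, fun g hg hfr => hne g ?_ ?_⟩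
    · simp only [hmk]
      refine ContinuousAt.comp (g := fun w => g (mk K w)) ?_ Complex.continuous_conj.continuousAt
      rwa [Complex.conj_conj]
    · have ht : Tendsto (starRingEnd ℂ) (𝓝[≠] c) (𝓝[≠] (starRingEnd ℂ c)) :=
        Complex.continuous_conj.continuousWithinAt.tendsto_nhdsWithin
          fun x hx h => hx ((starRingEnd ℂ).injective h)
      refine ht.frequently (hfr.mono fun w hw => ?_)
      rwa [mk_neg_conj]

theorem isDomainOfSliceRegularity_sigmaBall (I₀ : sliceUnits) (p : SliceCone) (r : ℝ) :
    IsDomainOfSliceRegularity (sigmaBall I₀ p r) := by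
  refine ⟨isOpen_sigmaBall I₀ p r, ?_⟩
  set S := sigmaBall I₀ p r
  rintro ⟨Ω₁, Ω₂, hΩ₁, hΩ₂, ⟨⟨q₁, hq₁⟩, hsub⟩, ⟨hconn, hnot⟩, hext⟩
  choose g hg hfg using hext
  have hD : IsOpen (Ω₂ ∩ S) := hΩ₂.inter (isOpen_sigmaBall I₀ p r)
  -- the family of all slice regular functions on the σ-ball, and their extensions
  let F : {f // SliceRegularOn f S} → SliceCone → Sedenion := fun f => f
  let G : {f // SliceRegularOn f S} → SliceCone → Sedenion := fun f => g f f.2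
  have hF : ∀ f, SliceRegularOn (F f) (Ω₂ ∩ S) := fun f => f.2.mono Set.inter_subset_right
  have hG : ∀ f, SliceRegularOn (G f) (Ω₂ ∩ S) := fun f =>
    (hg f f.2).mono Set.inter_subset_left
  set W := coincidenceSet F G (Ω₂ ∩ S)
  have hW : IsOpen W := isOpen_coincidenceSet hD hF hG
  have hW' : IsOpen (Ω₂ \ W) := by
    intro K
    refine isOpen_iff_mem_nhds.mpr fun z hz => ?_
    by_contra hcon
    have hfr : ∃ᶠ w in 𝓝 z, mk K w ∈ W := by
      intro hev
      refine hcon ?_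
      filter_upwards [hev, (hΩ₂ K).mem_nhds hz.1] with w hw hw2
      exact ⟨hw2, hw⟩
    by_cases hzS : mk K z ∈ S
    · exact hz.2 (mk_mem_coincidenceSet_of_frequently hD hF hG ⟨hz.1, hzS⟩ hfr)
    · obtain ⟨f, hf, hne⟩ := exists_sliceRegularOn_sigmaBall_ne hzS
      refine hne (g f hf) (hg f hf K z hz.1).1.continuousAt ?_
      rw [frequently_nhdsWithin_iff]
      refine hfr.mono fun w hw => ⟨?_, fun h => hzS ?_⟩
      · exact (eventually_eq_of_mk_mem_coincidenceSet hD hF hG hw).self_of_nhds ⟨f, hf⟩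
      · rw [← (h : w = z)]
        exact hw.1.2
  obtain ⟨q₂, hq₂, hq₂S⟩ := Set.not_subset.mp hnot
  have hq₁W : q₁ ∈ W := by
    obtain ⟨K, z, rfl⟩ := exists_mk_eq q₁
    refine ⟨hsub hq₁, K, z, rfl, ?_⟩
    filter_upwards [(hΩ₁ K).mem_nhds hq₁] with w hw f
    exact hfg f f.2 hw
  obtain ⟨q, -, hqW, -, hq⟩ := hconn.isPreconnected W (Ω₂ \ W) hW hW'
    (fun q hq => (em (q ∈ W)).imp_right fun h => ⟨hq, h⟩) ⟨q₁, (hsub hq₁).1, hq₁W⟩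
    ⟨q₂, hq₂, hq₂, fun h => hq₂S h.1.2⟩
  exact hq hqW

end Sedenion

theorem mainTheorem4 (I₀ : Sedenion.sliceUnits) (p : Sedenion.SliceCone) (r : ℝ) (hr : 0 < r) :
    Sedenion.IsDomainOfSliceRegularity (Sedenion.sigmaBall I₀ p r) :=
  Sedenion.isDomainOfSliceRegularity_sigmaBall I₀ p r
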